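/- Let $n$ and $t\ge 1$ be integers. Matrices on $\mathbb C^n\otimes(\mathbb C^n)^{\otimes t}$ have rows and columns indexed by pairs $(i_0,\underline i)\in[n]\times[n]^t$; the first tensor factor is called the A-register, the other $t$ factors the B-registers. $\mathrm{Herm}(\cdot)$ denotes the space of Hermitian matrices on a given space, with the inner product $\langle X,Y\rangle=\mathrm{Tr}(X^*Y)$, and $\succeq 0$ means positive semidefinite. For $\rho\in\mathrm{Herm}(\mathbb C^n\otimes(\mathbb C^n)^{\otimes t})$, let $\rho^{T_{B[s]}}$ be its partial transpose with respect to the first $s$ B-registers ($0\le s\le t$; for $s=0$ it is $\rho$), and let $\mathrm{Tr}_{B[2:t]}(\rho)\in \mathrm{Herm}(\mathbb C^n\otimes\mathbb C^n)$ be obtained by tracing out the last $t-1$ B-registers. Define: - $\mathrm{Herm}(\mathbb C^n\otimes S^t(\mathbb C^n))$, the set of $\rho\in\mathrm{Herm}(\mathbb C^n\otimes(\mathbb C^n)^{\otimes t})$ with $\rho_{i_0\underline i,\,j_0\underline j}=\rho_{i_0\underline i,\,j_0\underline j^\sigma}$ for all $i_0,j_0\in[n]$, $\underline i,\underline j\in[n]^t$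 and all permutations $\sigma$ of $[t]$, where $\underline j^\sigma=(j_{\sigma(1)},\dots,j_{\sigma(t)})$; and $\mathrm{Herm}(\mathbb C^n\otimes S^t(\mathbb C^n))^\perp$, its orthogonal complement in $\mathrm{Herm}(\mathbb C^n\otimes(\mathbb C^n)^{\otimes t})$; - $\mathcal W^{(t)}_{n,s}=\{\rho\in\mathrm{Herm}(\mathbb C^n\otimes(\mathbb C^n)^{\otimes t}):\rho^{T_{B[s]}}\succeq 0\}$ for $0\le s\le t$; - $\mathrm{DPS}^{(t)}_n=\{\mathrm{Tr}_{B[2:t]}(\rho):\rho\in\mathrm{Herm}(\mathbb C^n\otimes S^t(\mathbb C^n)),\ \rho^{T_{B[s]}}\succeq0\text{ for all }0\le s\le t\}$, and its dual cone $(\mathrm{DPS}^{(t)}_n)^*=\{M\in\mathrm{Herm}(\mathbb C^n\otimes\mathbb C^n):\langle M,\rho\rangle\ge 0\text{ for all }\rho\in\mathrm{DPS}^{(t)}_n\}$; - $\mathcal{DU}_n$, the group of diagonal matrices $\mathrm{Diag}(u)$ with $u\in\mathbb C^n$ and $|u_1|=\dots=|u_n|=1$; - $\mathrm{CLDUI}^{(t)}_n=\{\rho\in\mathrm{Herm}(\mathbb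 C^n\otimes(\mathbb C^n)^{\otimes t}):\rho=(U\otimes\overline U^{\otimes t})\,\rho\,(U\otimes\overline U^{\otimes t})^*\ \text{for all } U\in\mathcal{DU}_n\}$; - $\Pi_{\mathrm{CLDUI}_n}(M)=\int_{\mathcal{DU}_n}(U\otimes\overline U)\,M\,(U\otimes\overline U)^*\,dU$ for $M\in\mathrm{Herm}(\mathbb C^n\otimes\mathbb C^n)$, where $dU$ is the normalized Haar measure on $\mathcal{DU}_n$. **Corollary.** If $M\in(\mathrm{DPS}^{(t)}_n)^*$, then there exist matrices $$B\in\mathrm{Herm}(\mathbb C^n\otimes S^t(\mathbb C^n))^\perp\cap\mathrm{CLDUI}^{(t)}_n,\qquad W_s\in\mathcal W^{(t)}_{n,s}\cap\mathrm{CLDUI}^{(t)}_n\quad(s=0,1,\dots,t)$$ such that $$\Pi_{\mathrm{CLDUI}_n}(M)\otimes I_n^{\otimes(t-1)}=B+\sum_{s=0}^t W_s,$$ where $\Pi_{\mathrm{CLDUI}_n}(M)$ acts on the A-register and the first B-register, and the identities act on the remaining $t-1$ B-registers. Moreover, $\Pi_{\mathrm{CLDUI}_n}(M)\in(\mathrm{DPS}^{(t)}_n)^*$.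 -/

import Mathlib

open scoped ComplexOrder Kronecker

namespace DPSHierarchy

noncomputable section

/-- Index set of `ℂⁿ ⊗ ℂⁿ` (the A-register, then the B-register). -/
abbrev BiIdx (n : ℕ) : Type := Fin n × Fin n

/-- Index set of `ℂⁿ ⊗ (ℂⁿ)^{⊗ t}`: the A-register, then the `t` B-registers, which are numbered
`0, …, t - 1`. -/
abbrev ExtIdx (n t : ℕ) : Type := Fin n × (Fin t → Fin n)

/-- The trace inner product `⟨X, Y⟩ = Tr(X* Y)`. -/
def traceInner {ι : Type} [Fintype ι] (X Y : Matrix ι ι ℂ) : ℂ :=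
  (X.conjTranspose * Y).trace

/-- The tensor power `A^{⊗ t}`, a matrix acting on `(ℂⁿ)^{⊗ t}`. -/
def tensorPow {n : ℕ} (A : Matrix (Fin n) (Fin n) ℂ) (t : ℕ) :
    Matrix (Fin t → Fin n) (Fin t → Fin n) ℂ :=
  Matrix.of fun i j => ∏ k, A (i k) (j k)

/-- The diagonal unitary `Diag(u)` attached to `u ∈ 𝕋ⁿ`. -/
def diagU {n : ℕ} (u : Fin n → Circle) : Matrix (Fin n) (Fin n) ℂ :=
  Matrix.diagonal fun k => (u k : ℂ)

/-- The matrix `U ⊗ Ū`, where `Ū` is the entrywise conjugate of `U`. -/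
def localConj {n : ℕ} (U : Matrix (Fin n) (Fin n) ℂ) : Matrix (BiIdx n) (BiIdx n) ℂ :=
  U ⊗ₖ U.map star

/-- The matrix `U ⊗ Ū^{⊗ t}`. -/
def localConjExt {n : ℕ} (t : ℕ) (U : Matrix (Fin n) (Fin n) ℂ) :
    Matrix (ExtIdx n t) (ExtIdx n t) ℂ :=
  U ⊗ₖ tensorPow (U.map star) t

/-- The partial transpose `ρ^{T_{B[s]}}` with respect to the first `s` B-registers. -/
def partialTranspose {n t : ℕ} (s : ℕ) (ρ : Matrix (ExtIdx n t) (ExtIdx n t) ℂ) :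
    Matrix (ExtIdx n t) (ExtIdx n t) ℂ :=
  Matrix.of fun i j =>
    ρ (i.1, fun k => if (k : ℕ) < s then j.2 k else i.2 k)
      (j.1, fun k => if (k : ℕ) < s then i.2 k else j.2 k)

/-- The partial trace `Tr_{B[2:t]}`, tracing out all B-registers but the first one. Its entry at
`(i₀ a, j₀ b)` is the sum of the entries of `ρ` at `(i₀ a h, j₀ b h)` over all `h ∈ [n]^{t-1}`; such
an `h` is encoded by the sequence `k = a h`, and `Function.update k 0 b` is then `b h`. -/
def partialTrace {n t : ℕ} [NeZero t] (ρ : Matrix (ExtIdx n t) (ExtIdx n t) ℂ) :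
    Matrix (BiIdx n) (BiIdx n) ℂ :=
  Matrix.of fun i j =>
    ∑ k : Fin t → Fin n with k 0 = i.2, ρ (i.1, k) (j.1, Function.update k 0 j.2)

/-- `M ⊗ Iₙ^{⊗ (t-1)}`: `M` acts on the A-register and the first B-register, and the identity acts on
each of the other `t - 1` B-registers. -/
def tensorId {n : ℕ} (t : ℕ) [NeZero t] (M : Matrix (BiIdx n) (BiIdx n) ℂ) :
    Matrix (ExtIdx n t) (ExtIdx n t) ℂ :=
  Matrix.of fun i j =>
    M (i.1, i.2 0) (j.1, j.2 0) *
      ∏ k ∈ Finset.univ.erase (0 : Fin t), (1 : Matrix (Fin n) (Fin n) ℂ) (i.2 k) (j.2 k)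

/-- `Herm(ℂⁿ ⊗ Sᵗ(ℂⁿ))`: the Hermitian matrices on `ℂⁿ ⊗ (ℂⁿ)^{⊗ t}` with
`ρ (Iₙ ⊗ Πₜ) = ρ`, where `Πₜ` is the orthogonal projection onto the symmetric tensors; that is, `ρ` is
invariant under permuting the B-registers of its column index (hence also, being Hermitian, of its
row index). -/
def HermSym (n t : ℕ) : Set (Matrix (ExtIdx n t) (ExtIdx n t) ℂ) :=
  {ρ | ρ.IsHermitian ∧
    ∀ (σ : Equiv.Perm (Fin t)) (i j : ExtIdx n t), ρ i (j.1, j.2 ∘ σ) = ρ i j}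

/-- `Herm(ℂⁿ ⊗ Sᵗ(ℂⁿ))^⊥`, the orthogonal complement within the Hermitian matrices. -/
def HermSymPerp (n t : ℕ) : Set (Matrix (ExtIdx n t) (ExtIdx n t) ℂ) :=
  {B | B.IsHermitian ∧ ∀ ρ ∈ HermSym n t, traceInner B ρ = 0}

/-- The cone of Hermitian matrices whose partial transpose in the first `s` B-registers is positive
semidefinite. -/
def WCone (n t s : ℕ) : Set (Matrix (ExtIdx n t) (ExtIdx n t) ℂ) :=
  {ρ | ρ.IsHermitian ∧ (partialTranspose s ρ).PosSemidef}

/-- The cone `DPS^{(t)}ₙ`. -/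
def DPS (n t : ℕ) [NeZero t] : Set (Matrix (BiIdx n) (BiIdx n) ℂ) :=
  {ρ | ρ.IsHermitian ∧ ∃ R : Matrix (ExtIdx n t) (ExtIdx n t) ℂ,
    R ∈ HermSym n t ∧ (∀ s ≤ t, (partialTranspose s R).PosSemidef) ∧ partialTrace R = ρ}

/-- The dual cone `(DPS^{(t)}ₙ)*` within the Hermitian matrices. The inner product of two Hermitian
matrices is real, so that taking its real part loses nothing. -/
def DPSDual (n t : ℕ) [NeZero t] : Set (Matrix (BiIdx n) (BiIdx n) ℂ) :=
  {M | M.IsHermitian ∧ ∀ ρ ∈ DPS n t, 0 ≤ (traceInner M ρ).re}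

/-- `CLDUI^{(t)}ₙ`: the Hermitian matrices on `ℂⁿ ⊗ (ℂⁿ)^{⊗ t}` that are invariant under conjugation
by `U ⊗ Ū^{⊗ t}` for all diagonal unitaries `U`. -/
def CLDUIExt (n t : ℕ) : Set (Matrix (ExtIdx n t) (ExtIdx n t) ℂ) :=
  {ρ | ρ.IsHermitian ∧ ∀ u : Fin n → Circle,
    ρ = localConjExt t (diagU u) * ρ * (localConjExt t (diagU u)).conjTranspose}

/-- The projection onto the CLDUI matrices,
`Π_CLDUI(M) = ∫ (U ⊗ Ū) M (U ⊗ Ū)* dU`, an entrywise integral with respect to the normalized Haar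
measure on the group of diagonal unitaries. This group is parametrized through the isomorphism
`(ℝ/ℤ)ⁿ → 𝕋ⁿ`, `θ ↦ (exp(2πi θₖ))ₖ`, and `volume` is the Haar probability measure on `(ℝ/ℤ)ⁿ`. -/
def projCLDUI {n : ℕ} (M : Matrix (BiIdx n) (BiIdx n) ℂ) : Matrix (BiIdx n) (BiIdx n) ℂ :=
  Matrix.of fun i j => ∫ θ : Fin n → UnitAddCircle,
    (localConj (diagU fun k => AddCircle.toCircle (θ k)) * M *
      (localConj (diagU fun k => AddCircle.toCircle (θ k))).conjTranspose) i j

end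

end DPSHierarchy

namespace DPSHierarchy

/-! Conic duality gives the decomposition for M itself, and averaging over the torus then makes it
invariant. By `traceInner_tensorId`, M lies in the dual cone exactly when `tensorId t M` is
nonnegative on the symmetric matrices all of whose partial transposes are positive semidefinite.
Such a functional should be a sum of functionals `Tr (Y s * partialTranspose s ρ)` with `Y s`
positive semidefinite. The difficulty is closedness: partial transposes of symmetric matrices are
typically singular, so Slater's condition is not available directly.

It is replaced by a facial condition, the hypothesis `hface` of `exists_posSemidef_repr`. It is
checked on the product states built from `productVec`: a vector isotropic for all their partial
transposes of order `s` lies in the kernel of every partial transpose of that order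
(`partialTranspose_mulVec_eq_zero`). The reason is that a polynomial in z and its conjugate which
vanishes identically has zero coefficients.

Torus averaging amounts to deleting the entries between different weights (`pinch`). This keeps
every cone involved and commutes with tensoring by the identity, so it can be applied to the
decomposition term by term. Pairing the result with an extension R gives the final dual membership.
-/

/-! ### Convex hulls of compact sets and the bipolar theorem -/

theorem sum_eq_sum_of_embedding {ι κ F : Type*} [Fintype ι] [Fintype κ] [AddCommMonoid F]
    (e : ι ↪ κ) (g : κ → F) (h : ι → F) (h1 : ∀ i, g (e i) = h i)
    (h2 : ∀ k, (¬ ∃ i, e i = k) → g k = 0) : ∑ k, g k = ∑ i, h i :=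
  (Finset.sum_of_injOn e e.injective.injOn (by simp) (fun k _ hk => h2 k (by simpa using hk))
    fun i _ => (h1 i).symm).symm

/-- In finite dimension the convex hull of a compact set is compact. -/
theorem isCompact_convexHull_of_finiteDimensional {E : Type*} [NormedAddCommGroup E]
    [NormedSpace ℝ E] [FiniteDimensional ℝ E] {s : Set E} (hs : IsCompact s) :
    IsCompact (convexHull ℝ s) := by
  classical
  rcases s.eq_empty_or_nonempty with rfl | ⟨p, hp⟩
  · simp
  set N := Module.finrank ℝ E + 1
  have hcomp : IsCompact ((fun q : (Fin N → ℝ) × (Fin N → E) => ∑ i, q.1 i • q.2 i) ''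
      (stdSimplex ℝ (Fin N) ×ˢ Set.univ.pi fun _ => s)) := by
    refine IsCompact.image ((isCompact_stdSimplex ℝ _).prod (isCompact_univ_pi fun _ => hs)) ?_
    fun_prop
  convert hcomp using 1
  apply Set.Subset.antisymm
  · intro x hx
    obtain ⟨ι, _, z, w, hz, haff, hw0, hw1, hsum⟩ := eq_pos_convex_span_of_mem_convexHull hx
    have hcard : Fintype.card ι ≤ Fintype.card (Fin N) := by
      have := haff.card_le_finrank_succ
      rw [Fintype.card_fin]
      exact this.trans (Nat.succ_le_succ (Submodule.finrank_le _))
    obtain ⟨e⟩ := Function.Embedding.nonempty_of_card_le hcard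
    -- Carathéodory uses at most N points; the unused slots get weight 0 and the dummy point p.
    refine ⟨(Function.extend e w 0, Function.extend e z fun _ => p), ⟨⟨?_, ?_⟩, ?_⟩, ?_⟩
    · intro k
      by_cases hk : ∃ i, e i = k
      · obtain ⟨i, rfl⟩ := hk
        simpa [e.injective.extend_apply] using (hw0 i).le
      · simp [Function.extend_apply' _ _ _ hk]
    · rw [← hw1]
      exact sum_eq_sum_of_embedding e _ _ (fun i => e.injective.extend_apply _ _ _)
        fun k hk => Function.extend_apply' _ _ _ hk
    · intro k _
      by_cases hk : ∃ i, e i = k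
      · obtain ⟨i, rfl⟩ := hk
        simpa [e.injective.extend_apply] using hz ⟨i, rfl⟩
      · simpa [Function.extend_apply' _ _ _ hk] using hp
    · rw [← hsum]
      exact sum_eq_sum_of_embedding e _ _ (fun i => by simp [e.injective.extend_apply])
        fun k hk => by simp [Function.extend_apply' _ _ _ hk]
  · rintro _ ⟨⟨w, z⟩, ⟨⟨hw0, hw1⟩, hz⟩, rfl⟩
    exact (convex_convexHull ℝ s).sum_mem (fun i _ => hw0 i) hw1
      fun i _ => subset_convexHull ℝ s (hz i trivial)

/-- The bipolar theorem without closure: if every member of a compact set `X` is positive at some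
point of the dual cone of `X`, then the bidual of `X` is the convex cone spanned by `X`. -/
theorem mem_span_of_nonneg_on_dual {d : ℕ} {X : Set (Fin d → ℝ)} (hX : IsCompact X)
    (hpos : ∀ φ ∈ X, ∃ ρ : Fin d → ℝ, (∀ ψ ∈ X, 0 ≤ ψ ⬝ᵥ ρ) ∧ 0 < φ ⬝ᵥ ρ)
    {f : Fin d → ℝ} (hf : ∀ ρ : Fin d → ℝ, (∀ ψ ∈ X, 0 ≤ ψ ⬝ᵥ ρ) → 0 ≤ f ⬝ᵥ ρ) :
    f ∈ Submodule.span NNReal X := by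
  classical
  rcases X.eq_empty_or_nonempty with rfl | hne
  · have h := hf (-f) (by simp)
    have h0 : f = 0 := by
      rw [dotProduct_neg, neg_nonneg] at h
      have h' : 0 ≤ f ⬝ᵥ f := Finset.sum_nonneg fun i _ => mul_self_nonneg _
      exact dotProduct_self_eq_zero.1 (le_antisymm h h')
    rw [h0]; exact Submodule.zero_mem _
  have hsub : convexHull ℝ X ⊆ (Submodule.span NNReal X : Set (Fin d → ℝ)) := by
    refine convexHull_min Submodule.subset_span ?_
    intro x hx y hy a b ha hb _
    exact Submodule.add_mem _ (Submodule.smul_mem _ (⟨a, ha⟩ : NNReal) hx)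
      (Submodule.smul_mem _ (⟨b, hb⟩ : NNReal) hy)
  -- Being nonnegative on the dual cone and positive somewhere on it is a convex condition on φ: the
  -- sum of two witnesses serves a convex combination. The zero functional fails it.
  have hzero : (0 : Fin d → ℝ) ∉ convexHull ℝ X := by
    have hsub' : convexHull ℝ X ⊆ {φ | (∀ ρ : Fin d → ℝ, (∀ ψ ∈ X, 0 ≤ ψ ⬝ᵥ ρ) → 0 ≤ φ ⬝ᵥ ρ) ∧
        ∃ ρ : Fin d → ℝ, (∀ ψ ∈ X, 0 ≤ ψ ⬝ᵥ ρ) ∧ 0 < φ ⬝ᵥ ρ} := by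
      refine convexHull_min (fun φ hφ => ⟨fun ρ hρ => hρ φ hφ, hpos φ hφ⟩) ?_
      rintro x ⟨hx, ρ, hρ, hxρ⟩ y ⟨hy, ρ', hρ', hyρ'⟩ a b ha hb hab
      refine ⟨fun ρ hρ => ?_, ?_⟩
      · rw [add_dotProduct, smul_dotProduct, smul_dotProduct]
        exact add_nonneg (mul_nonneg ha (hx ρ hρ)) (mul_nonneg hb (hy ρ hρ))
      · refine ⟨ρ + ρ', fun ψ hψ => ?_, ?_⟩
        · rw [dotProduct_add]; exact add_nonneg (hρ ψ hψ) (hρ' ψ hψ)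
        · have h1 := hx ρ' hρ'
          have h2 := hy ρ hρ
          rw [add_dotProduct, smul_dotProduct, smul_dotProduct, dotProduct_add, dotProduct_add,
            smul_eq_mul, smul_eq_mul]
          rcases ha.eq_or_lt with rfl | ha'
          · have : b = 1 := by linarith
            subst this; linarith
          · have := mul_pos ha' (add_pos_of_pos_of_nonneg hxρ h1)
            have := mul_nonneg hb (add_nonneg h2 hyρ'.le)
            linarith
    intro h
    obtain ⟨_, ρ, _, h⟩ := hsub' h
    simp at h
  by_contra hfX
  -- If 0 = a(-f) + by, then a = 0 contradicts `hzero`, and a > 0 puts f = (b/a)y in the cone. A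
  -- functional separating 0 from this hull is then positive on X and negative at f.
  have hout : (0 : Fin d → ℝ) ∉ convexHull ℝ (insert (-f) X) := by
    rw [convexHull_insert hne, convexJoin_singleton_left, Set.mem_iUnion₂]
    rintro ⟨y, hy, a, b, ha, hb, hab, h⟩
    rcases ha.eq_or_lt with rfl | ha'
    · have : b = 1 := by linarith
      subst this
      apply hzero
      have hy0 : y = 0 := by simpa using h
      rwa [hy0] at hy
    · apply hfX
      have : f = (⟨a⁻¹ * b, by positivity⟩ : NNReal) • y := by
        change f = (a⁻¹ * b) • y
        have h' : a • f = b • y := by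
          rw [smul_neg, neg_add_eq_zero] at h
          exact h
        rw [mul_smul, ← h', smul_smul, inv_mul_cancel₀ ha'.ne', one_smul]
      rw [this]
      exact Submodule.smul_mem _ _ (hsub hy)
  obtain ⟨g, u, h0, hg⟩ := geometric_hahn_banach_point_closed (convex_convexHull ℝ _)
    (isCompact_convexHull_of_finiteDimensional (hX.insert (-f))).isClosed hout
  rw [map_zero] at h0
  have hgd : ∀ v : Fin d → ℝ, g v = v ⬝ᵥ fun i => g (Pi.single i 1) := by
    intro v
    have := LinearMap.pi_apply_eq_sum_univ (g : (Fin d → ℝ) →ₗ[ℝ] ℝ) v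
    simp only [ContinuousLinearMap.coe_coe] at this
    rw [this, dotProduct]
    refine Finset.sum_congr rfl fun i _ => ?_
    rw [smul_eq_mul]
    congr 2
    ext j
    simp [Pi.single_apply, eq_comm]
  have h1 : 0 ≤ f ⬝ᵥ fun i => g (Pi.single i 1) := by
    refine hf _ fun ψ hψ => ?_
    rw [← hgd]
    exact (h0.trans (hg ψ (subset_convexHull ℝ _ (Set.mem_insert_of_mem _ hψ)))).le
  have h2 := hg (-f) (subset_convexHull ℝ _ (Set.mem_insert _ _))
  rw [← hgd] at h1
  rw [map_neg] at h2
  linarith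

/-! ### Duality for spectrahedral cones -/

theorem posSemidef_of_isHermitian_of_re_nonneg {κ : Type*} [Fintype κ] {A : Matrix κ κ ℂ}
    (hA : A.IsHermitian) (h : ∀ x : κ → ℂ, 0 ≤ (star x ⬝ᵥ A.mulVec x).re) : A.PosSemidef := by
  refine Matrix.PosSemidef.of_dotProduct_mulVec_nonneg hA fun x => ?_
  rw [Complex.nonneg_iff]
  exact ⟨h x, (hA.im_star_dotProduct_mulVec_self x).symm⟩

theorem trace_vecMulVec_self_star_mul {κ : Type*} [Fintype κ] (x : κ → ℂ) (A : Matrix κ κ ℂ) :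
    (Matrix.vecMulVec x (star x) * A).trace = star x ⬝ᵥ A.mulVec x := by
  rw [Matrix.vecMulVec_mul, Matrix.trace_vecMulVec, Matrix.dotProduct_mulVec, dotProduct_comm]

/-- Duality for a spectrahedral cone `{ρ | ∀ s, L s ρ ⪰ 0}` in which every `L s` is as definite as
possible: the nonnegative functionals on it are exactly those represented by positive semidefinite
matrices. -/
theorem exists_posSemidef_repr {E S κ : Type*} [AddCommGroup E] [Module ℝ E]
    [FiniteDimensional ℝ E] [Fintype S] [Fintype κ] (L : S → E →ₗ[ℝ] Matrix κ κ ℂ)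
    (hL : ∀ s ρ, (L s ρ).IsHermitian)
    (hface : ∀ s (x : κ → ℂ),
      (∀ ρ, (∀ s', (L s' ρ).PosSemidef) → star x ⬝ᵥ (L s ρ).mulVec x = 0) →
        ∀ ρ, (L s ρ).mulVec x = 0)
    (f : E →ₗ[ℝ] ℝ) (hf : ∀ ρ, (∀ s, (L s ρ).PosSemidef) → 0 ≤ f ρ) :
    ∃ Y : S → Matrix κ κ ℂ, (∀ s, (Y s).PosSemidef) ∧
      ∀ ρ, f ρ = ∑ s, ((Y s * L s ρ).trace).re := by
  classical
  set b := Module.finBasis ℝ E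
  let φ (s : S) (x : κ → ℂ) : Fin (Module.finrank ℝ E) → ℝ :=
    fun i => (star x ⬝ᵥ (L s (b i)).mulVec x).re
  have hφ : ∀ s x c, φ s x ⬝ᵥ c = (star x ⬝ᵥ (L s (∑ i, c i • b i)).mulVec x).re := by
    intro s x c
    simp only [φ, dotProduct, map_sum, map_smul, Matrix.sum_mulVec, Matrix.smul_mulVec,
      Finset.sum_apply, Pi.smul_apply, Finset.mul_sum, Complex.re_sum]
    rw [Finset.sum_comm]
    refine Finset.sum_congr rfl fun i _ => ?_
    rw [Finset.sum_mul]
    refine Finset.sum_congr rfl fun k _ => ?_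
    rw [mul_smul_comm, Complex.smul_re, smul_eq_mul, mul_comm]
  -- Vectors in the common kernel `N s` give the zero functional. Keeping only unit vectors of its
  -- orthogonal complement makes the generating set X compact without changing its dual cone.
  let N (s : S) : Submodule ℂ (EuclideanSpace ℂ κ) :=
    { carrier := {x | ∀ ρ, (L s ρ).mulVec x.ofLp = 0}
      add_mem' := fun {x y} hx hy ρ => by
        rw [WithLp.ofLp_add, Matrix.mulVec_add, hx, hy, add_zero]
      zero_mem' := fun ρ => by simp
      smul_mem' := fun c x hx ρ => by
        rw [WithLp.ofLp_smul, Matrix.mulVec_smul, hx, smul_zero] }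
  let X : Set (Fin (Module.finrank ℝ E) → ℝ) :=
    ⋃ s, (fun x : EuclideanSpace ℂ κ => φ s x.ofLp) '' (Metric.sphere 0 1 ∩ (N s)ᗮ)
  have hXc : IsCompact X := by
    refine isCompact_iUnion fun s => IsCompact.image ?_ ?_
    · exact (isCompact_sphere _ _).inter_right (Submodule.isClosed_orthogonal _)
    · refine continuous_pi fun i => Complex.continuous_re.comp ?_
      refine Continuous.dotProduct ?_ ?_
      · exact (PiLp.continuous_ofLp 2 _).star
      · exact Continuous.matrix_mulVec continuous_const (PiLp.continuous_ofLp 2 _)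
  have hKX : ∀ c, (∀ s, (L s (∑ i, c i • b i)).PosSemidef) → ∀ ψ ∈ X, 0 ≤ ψ ⬝ᵥ c := by
    intro c hc ψ hψ
    obtain ⟨s, x, _, rfl⟩ := Set.mem_iUnion.1 hψ
    change 0 ≤ φ s x.ofLp ⬝ᵥ c
    rw [hφ]
    exact (Complex.nonneg_iff.1 ((hc s).dotProduct_mulVec_nonneg _)).1
  have hXK : ∀ c, (∀ ψ ∈ X, 0 ≤ ψ ⬝ᵥ c) → ∀ s, (L s (∑ i, c i • b i)).PosSemidef := by
    intro c hc s
    refine posSemidef_of_isHermitian_of_re_nonneg (hL s _) fun x => ?_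
    obtain ⟨y, hy, z, hz, hxyz⟩ := Submodule.exists_add_mem_mem_orthogonal (K := N s)
      (WithLp.toLp 2 x)
    have hx : x = y.ofLp + z.ofLp := by rw [← WithLp.ofLp_add, ← hxyz]
    set A := L s (∑ i, c i • b i) with hA
    have hAy : A.mulVec y.ofLp = 0 := hy _
    have hyA : Matrix.vecMul (star y.ofLp) A = 0 := by
      have hAh : A.IsHermitian := hL _ _
      rw [← hAh.eq, ← Matrix.star_mulVec, hAy, star_zero]
    have hred : star x ⬝ᵥ A.mulVec x = star z.ofLp ⬝ᵥ A.mulVec z.ofLp := by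
      rw [hx, Matrix.mulVec_add, hAy, zero_add, star_add, add_dotProduct,
        Matrix.dotProduct_mulVec (star y.ofLp), hyA, zero_dotProduct, zero_add]
    rw [hred]
    by_cases hz0 : z = 0
    · simp [hz0]
    have hzn : ‖z‖ ≠ 0 := norm_ne_zero_iff.2 hz0
    have hmem : φ s (((‖z‖ : ℂ)⁻¹ • z).ofLp) ∈ X := by
      refine Set.mem_iUnion.2 ⟨s, (‖z‖ : ℂ)⁻¹ • z, ⟨?_, Submodule.smul_mem _ _ hz⟩, rfl⟩
      rw [mem_sphere_zero_iff_norm, norm_smul, norm_inv, Complex.norm_real, norm_norm,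
        inv_mul_cancel₀ hzn]
    have h := hc _ hmem
    rw [hφ, ← hA, WithLp.ofLp_smul, star_smul, Matrix.mulVec_smul, smul_dotProduct,
      dotProduct_smul, smul_smul, smul_eq_mul] at h
    have hreal : star ((‖z‖ : ℂ)⁻¹) * (‖z‖ : ℂ)⁻¹ = ((‖z‖⁻¹ * ‖z‖⁻¹ : ℝ) : ℂ) := by
      simp
    rw [hreal, Complex.re_ofReal_mul] at h
    exact nonneg_of_mul_nonneg_right h (by positivity)
  have hcoord : ∀ ρ, ∑ i, b.repr ρ i • b i = ρ := fun ρ => b.sum_repr ρ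
  have hXpos : ∀ ψ ∈ X, ∃ c, (∀ ψ' ∈ X, 0 ≤ ψ' ⬝ᵥ c) ∧ 0 < ψ ⬝ᵥ c := by
    intro ψ hψ
    obtain ⟨s, x, ⟨hx1, hx2⟩, rfl⟩ := Set.mem_iUnion.1 hψ
    -- If the functional of x were zero on the whole cone, `hface` would put x in `N s`, so x would
    -- be orthogonal to itself despite having norm 1.
    by_contra! hcon
    have hxN : x ∈ N s := by
      refine hface s x.ofLp fun ρ hρ => ?_
      have h1 := hcon (b.repr ρ) (hKX _ (by rw [hcoord]; exact hρ))
      change φ s x.ofLp ⬝ᵥ _ ≤ 0 at h1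
      rw [hφ, hcoord] at h1
      have h2 := Complex.nonneg_iff.1 ((hρ s).dotProduct_mulVec_nonneg x.ofLp)
      exact Complex.ext (le_antisymm h1 h2.1) h2.2.symm
    have := Submodule.inner_right_of_mem_orthogonal hxN hx2
    rw [inner_self_eq_zero] at this
    rw [mem_sphere_zero_iff_norm, this] at hx1
    simp at hx1
  have hspan : (fun i => f (b i)) ∈ Submodule.span NNReal X := by
    refine mem_span_of_nonneg_on_dual hXc hXpos fun c hc => ?_
    have := hf _ (hXK c hc)
    rw [map_sum] at this
    simpa [dotProduct, mul_comm] using this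
  have hrepr : ∀ v ∈ Submodule.span NNReal X, ∃ Y : S → Matrix κ κ ℂ, (∀ s, (Y s).PosSemidef) ∧
      ∀ i, v i = ∑ s, ((Y s * L s (b i)).trace).re := by
    intro v hv
    induction hv using Submodule.span_induction with
    | mem v hv =>
      obtain ⟨s, x, _, rfl⟩ := Set.mem_iUnion.1 hv
      refine ⟨Pi.single s (Matrix.vecMulVec x.ofLp (star x.ofLp)), fun s' => ?_, fun i => ?_⟩
      · by_cases h : s' = s
        · subst h
          rw [Pi.single_eq_same]
          exact Matrix.posSemidef_vecMulVec_self_star _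
        · rw [Pi.single_eq_of_ne h]
          exact Matrix.PosSemidef.zero
      · rw [Finset.sum_eq_single s]
        · rw [Pi.single_eq_same, trace_vecMulVec_self_star_mul]
        · intro s' _ h
          rw [Pi.single_eq_of_ne h]
          simp
        · simp
    | zero => exact ⟨0, fun _ => Matrix.PosSemidef.zero, fun i => by simp⟩
    | add v w _ _ hv hw =>
      obtain ⟨Y, hY, hv⟩ := hv
      obtain ⟨Z, hZ, hw⟩ := hw
      refine ⟨Y + Z, fun s => (hY s).add (hZ s), fun i => ?_⟩
      simp [hv, hw, add_mul, Finset.sum_add_distrib]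
    | smul a v _ hv =>
      obtain ⟨Y, hY, hv⟩ := hv
      refine ⟨fun s => (a : ℝ) • Y s, fun s => (hY s).smul a.2, fun i => ?_⟩
      simp [hv, Finset.mul_sum, NNReal.smul_def]
  obtain ⟨Y, hY, hYf⟩ := hrepr _ hspan
  refine ⟨Y, hY, fun ρ => ?_⟩
  rw [← hcoord ρ, map_sum]
  simp only [map_smul, map_sum, Matrix.mul_sum, Matrix.trace_sum, Matrix.mul_smul,
    Matrix.trace_smul, Complex.re_sum, Complex.smul_re, smul_eq_mul]
  rw [Finset.sum_comm]
  refine Finset.sum_congr rfl fun i _ => ?_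
  rw [← Finset.mul_sum, ← hYf i]

/-! ### Polynomials in a vector and its conjugate, and symmetric tensors -/

/-- A polynomial in variables `z_k = X (true, k)` and `w_k = X (false, k)` that vanishes whenever
`w` is the complex conjugate of `z` is zero. -/
theorem mvPolynomial_eq_zero_of_conj {σ : Type*} (P : MvPolynomial (Bool × σ) ℂ)
    (h : ∀ b : σ → ℂ,
      MvPolynomial.eval (fun p => if p.1 then b p.2 else star (b p.2)) P = 0) : P = 0 := by
  -- Substitute z = x + iy and w = x - iy. At real x, y these are conjugate, so the new polynomial
  -- vanishes on all real points and is zero; the substitution is invertible over ℂ.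
  let g : Bool × σ → MvPolynomial (Bool × σ) ℂ := fun p =>
    MvPolynomial.X (true, p.2) +
      MvPolynomial.C (if p.1 then Complex.I else -Complex.I) * MvPolynomial.X (false, p.2)
  have heval : ∀ x (Q : MvPolynomial (Bool × σ) ℂ), MvPolynomial.eval x (MvPolynomial.aeval g Q) =
      MvPolynomial.eval (fun p => x (true, p.2) +
        (if p.1 then Complex.I else -Complex.I) * x (false, p.2)) Q := by
    intro x Q
    induction Q using MvPolynomial.induction_on with
    | C a => simp
    | add p q hp hq => rw [map_add, map_add, map_add, hp, hq]
    | mul_X p i hp => rw [map_mul, map_mul, map_mul, hp]; simp [g]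
  have hQ : MvPolynomial.aeval g P = 0 := by
    refine MvPolynomial.funext_set (fun _ => Set.range ((↑) : ℝ → ℂ))
      (fun _ => Set.infinite_range_of_injective Complex.ofReal_injective) fun x hx => ?_
    choose r hr using fun p => hx p trivial
    rw [heval, map_zero, ← h fun k => x (true, k) + Complex.I * x (false, k)]
    congr 2
    funext p
    rcases p with ⟨_ | _, k⟩
    · simp [← hr]
    · simp
  refine MvPolynomial.funext fun z => ?_
  have h0 := heval (fun p => if p.1 then (z (true, p.2) + z (false, p.2)) / 2 else
    (z (true, p.2) - z (false, p.2)) / (2 * Complex.I)) P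
  rw [hQ, map_zero] at h0
  rw [map_zero, h0]
  congr 2
  funext p
  have hI := Complex.I_ne_zero
  rcases p with ⟨_ | _, k⟩
  · simp
    field_simp
    ring
  · simp
    field_simp
    ring

/-- Two finite families with the same number of occurrences of every value are permutations of one
another. -/
theorem exists_perm_of_sum_single_eq {α β : Type*} [Fintype α] (p q : α → β)
    (h : ∑ k, Finsupp.single (p k) 1 = ∑ k, Finsupp.single (q k) (1 : ℕ)) :
    ∃ σ : Equiv.Perm α, ∀ k, q (σ k) = p k := by
  classical
  have hcard : ∀ b, Fintype.card {k // p k = b} = Fintype.card {k // q k = b} := by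
    intro b
    have := DFunLike.congr_fun h b
    simpa [Finsupp.finsetSum_apply, Finsupp.single_apply, Fintype.card_subtype] using this
  let e := ((Equiv.sigmaFiberEquiv p).symm.trans
    (Equiv.sigmaCongrRight fun b => Fintype.equivOfCardEq (hcard b))).trans
      (Equiv.sigmaFiberEquiv q)
  exact ⟨e, fun k => (Fintype.equivOfCardEq (hcard (p k)) ⟨k, rfl⟩).2⟩

/-- The number of occurrences of every index in the first `s` registers (flag `true`) and in the
remaining ones (flag `false`). -/
noncomputable def blockCount {n t : ℕ} (s : ℕ) (i : Fin t → Fin n) : (Bool × Fin n) →₀ ℕ :=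
  ∑ k : Fin t, Finsupp.single (decide ((k : ℕ) < s), i k) 1

/-- If the tensors `b^{⊗ s} ⊗ b̄^{⊗ (t - s)}` annihilate `x`, then so does every function that
depends only on the block counts. -/
theorem sum_mul_eq_zero_of_conj {n t : ℕ} (s : ℕ) (x F : (Fin t → Fin n) → ℂ)
    (hx : ∀ b : Fin n → ℂ,
      ∑ i, x i * ∏ k : Fin t, (if (k : ℕ) < s then b (i k) else star (b (i k))) = 0)
    (hF : ∀ i j, blockCount s i = blockCount s j → F i = F j) :
    ∑ i, F i * x i = 0 := by
  classical
  -- The coefficients of P are the sums of x over the fibres of `blockCount s`, and `hx` says that P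
  -- vanishes at all conjugate pairs.
  let P : MvPolynomial (Bool × Fin n) ℂ := ∑ i, MvPolynomial.monomial (blockCount s i) (x i)
  have hP : P = 0 := by
    refine mvPolynomial_eq_zero_of_conj P fun b => ?_
    rw [← hx b, map_sum]
    refine Finset.sum_congr rfl fun i _ => ?_
    rw [blockCount, MvPolynomial.monomial_sum_index]
    simp [MvPolynomial.eval_monomial]
  have hfib : ∀ m, ∑ i with blockCount s i = m, x i = 0 := by
    intro m
    have : MvPolynomial.coeff m P = 0 := by rw [hP, MvPolynomial.coeff_zero]
    simpa [P, MvPolynomial.coeff_sum, MvPolynomial.coeff_monomial, Finset.sum_filter] using this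
  rw [← Finset.sum_fiberwise_of_maps_to (t := Finset.univ.image (blockCount s))
    (g := blockCount s) fun i hi => Finset.mem_image_of_mem _ hi]
  refine Finset.sum_eq_zero fun m hm => ?_
  obtain ⟨i, _, rfl⟩ := Finset.mem_image.1 hm
  rw [Finset.sum_congr rfl (g := fun j => F i * x j), ← Finset.mul_sum, hfib, mul_zero]
  intro j hj
  rw [hF j i (Finset.mem_filter.1 hj).2]

/-! ### Partial transposition and the trace inner product -/

/-- The registers of `j` before `s` and those of `i` from `s` on. -/
def mixIdx {n t : ℕ} (s : ℕ) (i j : Fin t → Fin n) : Fin t → Fin n :=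
  fun k => if (k : ℕ) < s then j k else i k

theorem mixIdx_mixIdx {n t : ℕ} (s : ℕ) (i j : Fin t → Fin n) :
    mixIdx s (mixIdx s i j) (mixIdx s j i) = i := by
  funext k
  by_cases h : (k : ℕ) < s <;> simp [mixIdx, h]

theorem partialTranspose_apply {n t : ℕ} (s : ℕ) (ρ : Matrix (ExtIdx n t) (ExtIdx n t) ℂ)
    (i j : ExtIdx n t) :
    partialTranspose s ρ i j = ρ (i.1, mixIdx s i.2 j.2) (j.1, mixIdx s j.2 i.2) := rfl

theorem partialTranspose_partialTranspose {n t : ℕ} (s : ℕ)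
    (ρ : Matrix (ExtIdx n t) (ExtIdx n t) ℂ) :
    partialTranspose s (partialTranspose s ρ) = ρ := by
  ext i j
  simp [partialTranspose_apply, mixIdx_mixIdx]

theorem partialTranspose_isHermitian {n t : ℕ} (s : ℕ) {ρ : Matrix (ExtIdx n t) (ExtIdx n t) ℂ}
    (h : ρ.IsHermitian) : (partialTranspose s ρ).IsHermitian := by
  ext i j
  rw [Matrix.conjTranspose_apply, partialTranspose_apply, partialTranspose_apply, h.apply]

theorem traceInner_eq_sum {ι : Type} [Fintype ι] (X Y : Matrix ι ι ℂ) :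
    traceInner X Y = ∑ i, ∑ j, star (X i j) * Y i j := by
  rw [traceInner, Matrix.trace, Finset.sum_comm]
  rfl

theorem traceInner_add_left {ι : Type} [Fintype ι] (X X' Y : Matrix ι ι ℂ) :
    traceInner (X + X') Y = traceInner X Y + traceInner X' Y := by
  simp [traceInner, add_mul]

theorem traceInner_sub_left {ι : Type} [Fintype ι] (X X' Y : Matrix ι ι ℂ) :
    traceInner (X - X') Y = traceInner X Y - traceInner X' Y := by
  simp [traceInner, sub_mul]

theorem traceInner_sum_left {ι κ : Type} [Fintype ι] [Fintype κ] (X : κ → Matrix ι ι ℂ)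
    (Y : Matrix ι ι ℂ) : traceInner (∑ s, X s) Y = ∑ s, traceInner (X s) Y := by
  simp [traceInner, Matrix.conjTranspose_sum, Matrix.sum_mul, Matrix.trace_sum]

/-- The trace inner product of Hermitian matrices is real. -/
theorem traceInner_im_eq_zero {ι : Type} [Fintype ι] {X Y : Matrix ι ι ℂ} (hX : X.IsHermitian)
    (hY : Y.IsHermitian) : (traceInner X Y).im = 0 := by
  have h : star (traceInner X Y) = traceInner X Y := by
    rw [traceInner, ← Matrix.trace_conjTranspose, Matrix.conjTranspose_mul,
      Matrix.conjTranspose_conjTranspose, hY.eq, hX.eq, Matrix.trace_mul_comm]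
  exact Complex.conj_eq_iff_im.1 h

theorem traceInner_re_nonneg {ι : Type} [Fintype ι] {X Y : Matrix ι ι ℂ}
    (hX : X.PosSemidef) (hY : Y.PosSemidef) : 0 ≤ (traceInner X Y).re := by
  classical
  obtain ⟨m, v, hv⟩ := Matrix.posSemidef_iff_eq_sum_vecMulVec.1 hX
  rw [traceInner, hX.isHermitian.eq, hv, Matrix.sum_mul, Matrix.trace_sum, Complex.re_sum]
  refine Finset.sum_nonneg fun k _ => ?_
  rw [trace_vecMulVec_self_star_mul]
  exact (Complex.nonneg_iff.1 (hY.dotProduct_mulVec_nonneg _)).1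

/-- Partial transposition preserves the trace inner product. -/
theorem traceInner_partialTranspose {n t : ℕ} (s : ℕ)
    (X Y : Matrix (ExtIdx n t) (ExtIdx n t) ℂ) :
    traceInner (partialTranspose s X) (partialTranspose s Y) = traceInner X Y := by
  rw [traceInner_eq_sum, traceInner_eq_sum, ← Fintype.sum_prod_type', ← Fintype.sum_prod_type']
  let e : ExtIdx n t × ExtIdx n t → ExtIdx n t × ExtIdx n t :=
    fun p => ((p.1.1, mixIdx s p.1.2 p.2.2), (p.2.1, mixIdx s p.2.2 p.1.2))
  have he : Function.Involutive e := fun p => by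
    simp [e, mixIdx_mixIdx]
  exact Equiv.sum_comp he.toPerm fun p => star (X p.1 p.2) * Y p.1 p.2

theorem hermSym_row {n t : ℕ} {ρ : Matrix (ExtIdx n t) (ExtIdx n t) ℂ} (h : ρ ∈ HermSym n t)
    (σ : Equiv.Perm (Fin t)) (i j : ExtIdx n t) : ρ (i.1, i.2 ∘ σ) j = ρ i j := by
  rw [← h.1.apply, h.2, h.1.apply]

/-- A permutation that preserves the set of the first `s` registers acts on these registers only,
and on the others only. -/
theorem exists_mixIdx_comp {n t : ℕ} (s : ℕ) (σ : Equiv.Perm (Fin t))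
    (hσ : ∀ k, ((σ k : ℕ) < s ↔ (k : ℕ) < s)) (l i : Fin t → Fin n) :
    (∃ τ : Equiv.Perm (Fin t), mixIdx s l (i ∘ σ) = mixIdx s l i ∘ τ) ∧
      ∃ τ : Equiv.Perm (Fin t), mixIdx s (i ∘ σ) l = mixIdx s i l ∘ τ := by
  constructor
  · refine ⟨Equiv.Perm.ofSubtype (σ.subtypePerm (p := fun k : Fin t => (k : ℕ) < s) hσ), ?_⟩
    funext k
    by_cases hk : (k : ℕ) < s
    · have := (hσ k).2 hk
      simp [mixIdx, hk, this,
        Equiv.Perm.ofSubtype_apply_of_mem (p := fun k : Fin t => (k : ℕ) < s) _ hk]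
    · simp [mixIdx, hk,
        Equiv.Perm.ofSubtype_apply_of_not_mem (p := fun k : Fin t => (k : ℕ) < s) _ hk]
  · refine ⟨Equiv.Perm.ofSubtype
      (σ.subtypePerm (p := fun k : Fin t => ¬ (k : ℕ) < s) fun k => not_congr (hσ k)), ?_⟩
    funext k
    by_cases hk : (k : ℕ) < s
    · simp [mixIdx, hk,
        Equiv.Perm.ofSubtype_apply_of_not_mem (p := fun k : Fin t => ¬ (k : ℕ) < s) _ (not_not.2 hk)]
    · have := not_congr (hσ k)
      simp [mixIdx, hk,
        Equiv.Perm.ofSubtype_apply_of_mem (p := fun k : Fin t => ¬ (k : ℕ) < s) _ hk]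
      intro h
      exact absurd h (this.2 hk)

/-- Equal block counts mean that i and j differ by a permutation preserving the first `s` registers.
After transposition it splits into one permutation of the row index and one of the column index, and
ρ is invariant under both. -/
theorem partialTranspose_eq_of_blockCount_eq {n t : ℕ} (s : ℕ)
    {ρ : Matrix (ExtIdx n t) (ExtIdx n t) ℂ} (h : ρ ∈ HermSym n t) (l : ExtIdx n t) (a : Fin n)
    {i j : Fin t → Fin n} (hij : blockCount s i = blockCount s j) :
    partialTranspose s ρ l (a, i) = partialTranspose s ρ l (a, j) := by
  obtain ⟨σ, hσ⟩ := exists_perm_of_sum_single_eq _ _ hij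
  simp only [Prod.mk.injEq, decide_eq_decide] at hσ
  have hi : i = j ∘ σ := funext fun k => (hσ k).2.symm
  obtain ⟨⟨τ, hτ⟩, ⟨τ', hτ'⟩⟩ := exists_mixIdx_comp s σ (fun k => (hσ k).1) l.2 j
  rw [partialTranspose_apply, partialTranspose_apply]
  simp only [hi, hτ, hτ']
  exact (h.2 τ' _ (a, mixIdx s j l.2)).trans (hermSym_row h τ (l.1, mixIdx s l.2 j) _)

/-! ### Product states and the facial condition -/

/-- The vector `e_a ⊗ b^{⊗ t}` with the first `s` B-factors conjugated. -/
def productVec {n : ℕ} (t s : ℕ) (a : Fin n) (b : Fin n → ℂ) : ExtIdx n t → ℂ :=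
  fun i => if i.1 = a then
    ∏ k : Fin t, (if (k : ℕ) < s then star (b (i.2 k)) else b (i.2 k)) else 0

theorem productVec_apply_zero {n : ℕ} (t : ℕ) (a : Fin n) (b : Fin n → ℂ) (i : ExtIdx n t) :
    productVec t 0 a b i = if i.1 = a then ∏ k : Fin t, b (i.2 k) else 0 := by
  simp [productVec]

theorem productVec_mem_hermSym {n : ℕ} (t : ℕ) (a : Fin n) (b : Fin n → ℂ) :
    Matrix.vecMulVec (productVec t 0 a b) (star (productVec t 0 a b)) ∈ HermSym n t := by
  refine ⟨(Matrix.posSemidef_vecMulVec_self_star _).isHermitian, fun σ i j => ?_⟩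
  simp only [Matrix.vecMulVec_apply, Pi.star_apply, productVec_apply_zero, Function.comp_apply]
  rw [Equiv.prod_comp σ fun k => b (j.2 k)]

/-- Transposing a rank-one tensor factor conjugates its vector. Hence these states have all partial
transposes positive semidefinite and belong to the cone. -/
theorem partialTranspose_productVec {n : ℕ} (t s : ℕ) (a : Fin n) (b : Fin n → ℂ) :
    partialTranspose s
        (Matrix.vecMulVec (productVec t 0 a b) (star (productVec t 0 a b))) =
      Matrix.vecMulVec (productVec t s a b) (star (productVec t s a b)) := by
  ext i j
  simp only [partialTranspose_apply, Matrix.vecMulVec_apply, Pi.star_apply,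
    productVec_apply_zero]
  by_cases hi : i.1 = a
  · by_cases hj : j.1 = a
    · simp only [productVec, hi, hj, if_true, star_prod, ← Finset.prod_mul_distrib]
      refine Finset.prod_congr rfl fun k _ => ?_
      by_cases hk : (k : ℕ) < s <;> simp [mixIdx, hk, mul_comm]
    · simp [productVec, hj]
  · simp [productVec, hi]

/-- `Herm(ℂⁿ ⊗ Sᵗ(ℂⁿ))` as a real vector space. -/
def hermSymSubmodule (n t : ℕ) : Submodule ℝ (Matrix (ExtIdx n t) (ExtIdx n t) ℂ) where
  carrier := HermSym n t
  add_mem' := fun {x y} hx hy => ⟨hx.1.add hy.1, fun σ i j => by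
    rw [Matrix.add_apply, Matrix.add_apply, hx.2, hy.2]⟩
  zero_mem' := ⟨Matrix.isHermitian_zero, fun _ _ _ => rfl⟩
  smul_mem' := fun c x hx => ⟨hx.1.smul (IsSelfAdjoint.all c), fun σ i j => by
    rw [Matrix.smul_apply, Matrix.smul_apply, hx.2]⟩

/-- Partial transposition as a linear map on `Herm(ℂⁿ ⊗ Sᵗ(ℂⁿ))`. -/
def partialTransposeLin (n t s : ℕ) :
    hermSymSubmodule n t →ₗ[ℝ] Matrix (ExtIdx n t) (ExtIdx n t) ℂ where
  toFun ρ := partialTranspose s ρ.1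
  map_add' _ _ := rfl
  map_smul' _ _ := rfl

/-- The partial transposes of the product states are as definite as possible. -/
theorem partialTranspose_mulVec_eq_zero {n t : ℕ} (s : ℕ) (x : ExtIdx n t → ℂ)
    (hx : ∀ a b, star x ⬝ᵥ
      (Matrix.vecMulVec (productVec t s a b) (star (productVec t s a b))).mulVec x = 0)
    {ρ : Matrix (ExtIdx n t) (ExtIdx n t) ℂ} (h : ρ ∈ HermSym n t) :
    (partialTranspose s ρ).mulVec x = 0 := by
  -- The quadratic form in `hx` is the squared modulus of this inner product.
  have hv : ∀ a b, star (productVec t s a b) ⬝ᵥ x = 0 := by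
    intro a b
    have h1 := hx a b
    rw [← trace_vecMulVec_self_star_mul, Matrix.trace_mul_comm,
      trace_vecMulVec_self_star_mul] at h1
    have h2 : star (productVec t s a b) ⬝ᵥ (Matrix.vecMulVec x (star x)).mulVec
        (productVec t s a b) = (star (productVec t s a b) ⬝ᵥ x) *
          star (star (productVec t s a b) ⬝ᵥ x) := by
      have h3 : star (star (productVec t s a b) ⬝ᵥ x) = star x ⬝ᵥ productVec t s a b := by
        simp [dotProduct, mul_comm]
      rw [h3, Matrix.vecMulVec_mulVec, dotProduct_smul]
      rfl
    rw [h2] at h1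
    exact (CStarRing.mul_star_self_eq_zero_iff _).1 h1
  funext l
  rw [Matrix.mulVec, dotProduct, Fintype.sum_prod_type, Pi.zero_apply]
  refine Finset.sum_eq_zero fun a _ => ?_
  refine sum_mul_eq_zero_of_conj s (fun i => x (a, i)) _ (fun b => ?_) fun i j hij =>
    partialTranspose_eq_of_blockCount_eq s h l a hij
  have := hv a b
  rw [dotProduct, Fintype.sum_prod_type, Finset.sum_eq_single a] at this
  · rw [← this]
    refine Finset.sum_congr rfl fun i _ => ?_
    rw [mul_comm]
    simp [productVec, apply_ite]
  · intro a' _ ha'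
    simp [productVec, ha']
  · simp

/-! ### Tensoring with the identity, and the decomposition without invariance -/

theorem tensorId_update {n t : ℕ} [NeZero t] (M : Matrix (BiIdx n) (BiIdx n) ℂ) (i : ExtIdx n t)
    (c d : Fin n) :
    tensorId t M i (c, Function.update i.2 0 d) = M (i.1, i.2 0) (c, d) := by
  rw [tensorId, Matrix.of_apply, Finset.prod_eq_one, mul_one]
  · simp
  intro k hk
  exact (congrArg _ (Function.update_of_ne (Finset.ne_of_mem_erase hk) _ _)).trans
    (Matrix.one_apply_eq (i.2 k))

theorem tensorId_eq_zero {n t : ℕ} [NeZero t] (M : Matrix (BiIdx n) (BiIdx n) ℂ)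
    (i j : ExtIdx n t) (h : j.2 ≠ Function.update i.2 0 (j.2 0)) : tensorId t M i j = 0 := by
  obtain ⟨k, hk⟩ := Function.ne_iff.1 h
  have hk0 : k ≠ 0 := by
    rintro rfl
    simp at hk
  rw [Function.update_of_ne hk0] at hk
  rw [tensorId, Matrix.of_apply, Finset.prod_eq_zero (i := k), mul_zero]
  · simpa using hk0
  · exact Matrix.one_apply_ne fun h => hk h.symm

theorem sum_tensorId_mul {n t : ℕ} [NeZero t] (M : Matrix (BiIdx n) (BiIdx n) ℂ)
    (g : ExtIdx n t → ℂ) (i : ExtIdx n t) :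
    ∑ j, star (tensorId t M i j) * g j =
      ∑ p : BiIdx n, star (M (i.1, i.2 0) p) * g (p.1, Function.update i.2 0 p.2) := by
  symm
  refine Finset.sum_of_injOn (fun p : BiIdx n => ((p.1, Function.update i.2 0 p.2) : ExtIdx n t))
    ?_ (by simp) ?_ ?_
  · rintro ⟨c, d⟩ _ ⟨c', d'⟩ _ h
    simp only [Prod.mk.injEq] at h
    have := congrFun h.2 0
    simp only [Function.update_self] at this
    rw [h.1, this]
  · intro j _ hj
    rw [tensorId_eq_zero, star_zero, zero_mul]
    intro h
    exact hj ⟨(j.1, j.2 0), by simp, Prod.ext rfl h.symm⟩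
  · rintro ⟨c, d⟩ _
    rw [tensorId_update]

/-- `M ↦ M ⊗ I` is adjoint to the partial trace. -/
theorem traceInner_tensorId {n t : ℕ} [NeZero t] (M : Matrix (BiIdx n) (BiIdx n) ℂ)
    (R : Matrix (ExtIdx n t) (ExtIdx n t) ℂ) :
    traceInner (tensorId t M) R = traceInner M (partialTrace R) := by
  rw [traceInner_eq_sum, traceInner_eq_sum]
  simp only [sum_tensorId_mul, partialTrace, Matrix.of_apply, Finset.mul_sum]
  rw [Fintype.sum_prod_type, Fintype.sum_prod_type]
  refine Finset.sum_congr rfl fun a _ => ?_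
  rw [← Finset.sum_fiberwise Finset.univ (fun k : Fin t → Fin n => k 0)]
  refine Finset.sum_congr rfl fun b _ => ?_
  rw [Finset.sum_comm]
  refine Finset.sum_congr rfl fun p _ => Finset.sum_congr rfl fun k hk => ?_
  obtain rfl : k 0 = b := (Finset.mem_filter.1 hk).2
  rfl

theorem tensorId_isHermitian {n t : ℕ} [NeZero t] {M : Matrix (BiIdx n) (BiIdx n) ℂ}
    (h : M.IsHermitian) : (tensorId t M).IsHermitian := by
  ext i j
  rw [Matrix.conjTranspose_apply, tensorId, Matrix.of_apply, Matrix.of_apply, star_mul', h.apply,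
    star_prod]
  congr 1
  refine Finset.prod_congr rfl fun k _ => ?_
  exact Matrix.isHermitian_one.apply _ _

theorem partialTrace_isHermitian {n t : ℕ} [NeZero t]
    {R : Matrix (ExtIdx n t) (ExtIdx n t) ℂ} (h : R.IsHermitian) :
    (partialTrace R).IsHermitian := by
  ext i j
  rw [Matrix.conjTranspose_apply, partialTrace, Matrix.of_apply, Matrix.of_apply, star_sum]
  refine Finset.sum_bij' (fun k _ => Function.update k 0 i.2) (fun k _ => Function.update k 0 j.2)
    ?_ ?_ ?_ ?_ ?_
  · simp
  · simp
  · intro k hk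
    rw [← (Finset.mem_filter.1 hk).2]
    simp
  · intro k hk
    rw [← (Finset.mem_filter.1 hk).2]
    simp
  · intro k hk
    rw [h.apply, ← (Finset.mem_filter.1 hk).2]
    simp

/-- The decomposition of `M ⊗ I` for `M` in the dual cone, without any invariance. -/
theorem exists_decomposition {n t : ℕ} [NeZero t] {M : Matrix (BiIdx n) (BiIdx n) ℂ}
    (hM : M ∈ DPSDual n t) :
    ∃ (B : Matrix (ExtIdx n t) (ExtIdx n t) ℂ)
      (W : Fin (t + 1) → Matrix (ExtIdx n t) (ExtIdx n t) ℂ),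
      B ∈ HermSymPerp n t ∧ (∀ s : Fin (t + 1), W s ∈ WCone n t s) ∧
        tensorId t M = B + ∑ s, W s := by
  let f : hermSymSubmodule n t →ₗ[ℝ] ℝ :=
    { toFun := fun ρ => (traceInner (tensorId t M) ρ.1).re
      map_add' := fun x y => by simp [traceInner, Matrix.mul_add]
      map_smul' := fun c x => by simp [traceInner] }
  obtain ⟨Y, hY, hYf⟩ := exists_posSemidef_repr
    (fun s : Fin (t + 1) => partialTransposeLin n t s)
    (fun s ρ => partialTranspose_isHermitian s ρ.2.1)
    (fun s x hx ρ => by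
      refine partialTranspose_mulVec_eq_zero (s : ℕ) x (fun a b => ?_) ρ.2
      rw [← partialTranspose_productVec]
      refine hx ⟨_, productVec_mem_hermSym t a b⟩ fun s' => ?_
      change (partialTranspose s' _).PosSemidef
      rw [partialTranspose_productVec]
      exact Matrix.posSemidef_vecMulVec_self_star _)
    f (fun ρ hρ => by
      change 0 ≤ (traceInner (tensorId t M) ρ.1).re
      rw [traceInner_tensorId]
      exact hM.2 _ ⟨partialTrace_isHermitian ρ.2.1, ρ.1, ρ.2,
        fun s hs => hρ ⟨s, Nat.lt_succ_of_le hs⟩, rfl⟩)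
  have hW : ∀ s : Fin (t + 1), partialTranspose s (Y s) ∈ WCone n t s := fun s =>
    ⟨partialTranspose_isHermitian s (hY s).isHermitian, by
      rw [partialTranspose_partialTranspose]; exact hY s⟩
  have hWsum : (∑ s : Fin (t + 1), partialTranspose (s : ℕ) (Y s)).IsHermitian := by
    rw [Matrix.IsHermitian, Matrix.conjTranspose_sum]
    exact Finset.sum_congr rfl fun s _ => (hW s).1.eq
  -- The representation by the `Y s` holds only on symmetric matrices; B is the discrepancy, hence
  -- orthogonal to them.
  refine ⟨tensorId t M - ∑ s : Fin (t + 1), partialTranspose (s : ℕ) (Y s),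
    fun s => partialTranspose (s : ℕ) (Y s), ⟨(tensorId_isHermitian hM.1).sub hWsum, ?_⟩, hW,
    (sub_add_cancel _ _).symm⟩
  intro ρ hρ
  refine Complex.ext ?_ (traceInner_im_eq_zero ((tensorId_isHermitian hM.1).sub hWsum) hρ.1)
  have h := hYf ⟨ρ, hρ⟩
  change (traceInner (tensorId t M) ρ).re =
    ∑ s : Fin (t + 1), ((Y s * partialTranspose s ρ).trace).re at h
  rw [traceInner_sub_left, traceInner_sum_left, Complex.sub_re, h, Complex.re_sum, Complex.zero_re,
    sub_eq_zero]
  refine Finset.sum_congr rfl fun s _ => ?_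
  rw [← traceInner_partialTranspose s, partialTranspose_partialTranspose, traceInner,
    (hY s).isHermitian.eq]

/-! ### Pinching by torus weights -/

/-- The entries of `A` between indices of equal weight, the others being replaced by zero. -/
def pinch {κ γ : Type*} [DecidableEq γ] (w : κ → γ) (A : Matrix κ κ ℂ) : Matrix κ κ ℂ :=
  Matrix.of fun i j => if w i = w j then A i j else 0

theorem pinch_apply {κ γ : Type*} [DecidableEq γ] (w : κ → γ) (A : Matrix κ κ ℂ) (i j : κ) :
    pinch w A i j = if w i = w j then A i j else 0 := rfl

/-- Pinching is the sum of the compressions by the coordinate projections onto the weight spaces. -/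
theorem pinch_posSemidef {κ γ : Type*} [Fintype κ] [DecidableEq γ] (w : κ → γ) {A : Matrix κ κ ℂ}
    (hA : A.PosSemidef) : (pinch w A).PosSemidef := by
  classical
  have h : pinch w A = ∑ c ∈ Finset.univ.image w,
      Matrix.diagonal (fun i => if w i = c then (1 : ℂ) else 0) * A *
        (Matrix.diagonal fun i => if w i = c then (1 : ℂ) else 0).conjTranspose := by
    ext i j
    simp only [Matrix.sum_apply, Matrix.diagonal_conjTranspose, Matrix.mul_diagonal,
      Matrix.diagonal_mul]
    rw [Finset.sum_eq_single (w i)]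
    · by_cases hij : w i = w j
      · simp [pinch_apply, hij]
      · simp [pinch_apply, hij, Ne.symm hij]
    · intro c _ hc
      simp [Ne.symm hc]
    · intro h
      exact absurd (Finset.mem_image_of_mem w (Finset.mem_univ i)) h
  rw [h]
  exact Matrix.posSemidef_sum _ fun c _ => hA.mul_mul_conjTranspose_same _

theorem pinch_isHermitian {κ γ : Type*} [DecidableEq γ] (w : κ → γ) {A : Matrix κ κ ℂ}
    (hA : A.IsHermitian) : (pinch w A).IsHermitian := by
  ext i j
  rw [Matrix.conjTranspose_apply, pinch_apply, pinch_apply, apply_ite star, hA.apply, star_zero]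
  simp only [eq_comm]

theorem pinch_add {κ γ : Type*} [DecidableEq γ] (w : κ → γ) (A B : Matrix κ κ ℂ) :
    pinch w (A + B) = pinch w A + pinch w B := by
  ext i j
  by_cases h : w i = w j <;> simp [pinch_apply, h]

theorem pinch_sum {κ γ ι : Type*} [Fintype ι] [DecidableEq γ] (w : κ → γ)
    (A : ι → Matrix κ κ ℂ) : pinch w (∑ s, A s) = ∑ s, pinch w (A s) := by
  ext i j
  by_cases h : w i = w j <;> simp [pinch_apply, h, Matrix.sum_apply]

theorem traceInner_pinch {κ : Type} {γ : Type*} [Fintype κ] [DecidableEq γ] (w : κ → γ)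
    (A B : Matrix κ κ ℂ) : traceInner (pinch w A) B = traceInner A (pinch w B) := by
  rw [traceInner_eq_sum, traceInner_eq_sum]
  refine Finset.sum_congr rfl fun i _ => Finset.sum_congr rfl fun j _ => ?_
  by_cases h : w i = w j <;> simp [pinch_apply, h]

/-- The weight of a basis vector under the action `U ↦ U ⊗ Ū` of the diagonal unitaries. -/
def biWeight {n : ℕ} (i : BiIdx n) : Fin n → ℤ := Pi.single i.1 1 - Pi.single i.2 1

/-- The weight of a basis vector under the action `U ↦ U ⊗ Ū^{⊗ t}` of the diagonal unitaries. -/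
def extWeight {n t : ℕ} (i : ExtIdx n t) : Fin n → ℤ :=
  Pi.single i.1 1 - ∑ k, Pi.single (i.2 k) 1

/-- The weight of a basis vector after transposition of the first `s` B-registers. -/
def transposedWeight {n t : ℕ} (s : ℕ) (i : ExtIdx n t) : Fin n → ℤ :=
  Pi.single i.1 1 - ∑ k : Fin t, (if (k : ℕ) < s then -1 else 1 : ℤ) • Pi.single (i.2 k) 1

theorem partialTranspose_pinch {n t : ℕ} (s : ℕ) (A : Matrix (ExtIdx n t) (ExtIdx n t) ℂ) :
    partialTranspose s (pinch extWeight A) =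
      pinch (transposedWeight s) (partialTranspose s A) := by
  ext i j
  rw [partialTranspose_apply, pinch_apply, pinch_apply, partialTranspose_apply]
  refine if_congr ?_ rfl rfl
  -- Swapping a register between row and column flips the sign of its contribution to the weight
  -- difference, which is the sign built into `transposedWeight`.
  have h : extWeight (i.1, mixIdx s i.2 j.2) - extWeight (j.1, mixIdx s j.2 i.2) =
      transposedWeight s i - transposedWeight s j := by
    have h' : ∑ k, (Pi.single (mixIdx s i.2 j.2 k) 1 : Fin n → ℤ) -
        ∑ k, Pi.single (mixIdx s j.2 i.2 k) 1 =
        ∑ k : Fin t, (if (k : ℕ) < s then -1 else 1 : ℤ) • (Pi.single (i.2 k) 1 : Fin n → ℤ) -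
          ∑ k : Fin t, (if (k : ℕ) < s then -1 else 1 : ℤ) • Pi.single (j.2 k) 1 := by
      rw [← Finset.sum_sub_distrib, ← Finset.sum_sub_distrib]
      refine Finset.sum_congr rfl fun k _ => ?_
      by_cases hk : (k : ℕ) < s
      · simp only [mixIdx, hk, if_true, neg_smul, one_smul]
        abel
      · simp [mixIdx, hk]
    simp only [extWeight, transposedWeight]
    rw [sub_sub_sub_comm, h', sub_sub_sub_comm]
  rw [← sub_eq_zero, h, sub_eq_zero]

theorem extWeight_comp {n t : ℕ} (σ : Equiv.Perm (Fin t)) (i : ExtIdx n t) :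
    extWeight (i.1, i.2 ∘ σ) = extWeight i := by
  simp only [extWeight, Function.comp_apply]
  rw [Equiv.sum_comp σ fun k => (Pi.single (i.2 k) 1 : Fin n → ℤ)]

theorem pinch_mem_hermSym {n t : ℕ} {ρ : Matrix (ExtIdx n t) (ExtIdx n t) ℂ}
    (h : ρ ∈ HermSym n t) : pinch extWeight ρ ∈ HermSym n t := by
  refine ⟨pinch_isHermitian _ h.1, fun σ i j => ?_⟩
  rw [pinch_apply, pinch_apply, extWeight_comp, h.2]

theorem pinch_mem_hermSymPerp {n t : ℕ} {B : Matrix (ExtIdx n t) (ExtIdx n t) ℂ}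
    (h : B ∈ HermSymPerp n t) : pinch extWeight B ∈ HermSymPerp n t := by
  refine ⟨pinch_isHermitian _ h.1, fun ρ hρ => ?_⟩
  rw [traceInner_pinch]
  exact h.2 _ (pinch_mem_hermSym hρ)

theorem pinch_mem_wCone {n t s : ℕ} {W : Matrix (ExtIdx n t) (ExtIdx n t) ℂ}
    (h : W ∈ WCone n t s) : pinch extWeight W ∈ WCone n t s := by
  refine ⟨pinch_isHermitian _ h.1, ?_⟩
  rw [partialTranspose_pinch]
  exact pinch_posSemidef _ h.2

theorem pinch_tensorId {n t : ℕ} [NeZero t] (M : Matrix (BiIdx n) (BiIdx n) ℂ) :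
    pinch extWeight (tensorId t M) = tensorId t (pinch biWeight M) := by
  ext i j
  rw [pinch_apply]
  by_cases h : j.2 = Function.update i.2 0 (j.2 0)
  · have hj : j = (j.1, Function.update i.2 0 (j.2 0)) := Prod.ext rfl h
    have hiff : extWeight i = extWeight j ↔ biWeight (i.1, i.2 0) = biWeight (j.1, j.2 0) := by
      -- Here i and j agree on the B-registers other than the first, whose contributions cancel.
      have hdiff : extWeight i - extWeight j =
          biWeight (i.1, i.2 0) - biWeight (j.1, j.2 0) := by
        have h' : ∑ k, (Pi.single (i.2 k) 1 : Fin n → ℤ) - ∑ k, Pi.single (j.2 k) 1 =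
            Pi.single (i.2 0) 1 - Pi.single (j.2 0) 1 := by
          rw [← Finset.sum_sub_distrib, Finset.sum_eq_single 0]
          · intro k _ hk
            rw [h, Function.update_of_ne hk, sub_self]
          · simp
        simp only [extWeight, biWeight]
        rw [sub_sub_sub_comm, h', sub_sub_sub_comm]
      rw [← sub_eq_zero, hdiff, sub_eq_zero]
    rw [hj, tensorId_update, tensorId_update, ← hj, pinch_apply]
    exact if_congr hiff rfl rfl
  · rw [tensorId_eq_zero _ _ _ h, tensorId_eq_zero _ _ _ h, ite_self]

/-! ### Diagonal unitaries and the Haar average -/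

theorem zpow_sum_eq_prod {G ι : Type*} [CommGroup G] (g : G) (s : Finset ι) (f : ι → ℤ) :
    g ^ (∑ k ∈ s, f k) = ∏ k ∈ s, g ^ f k := by
  classical
  induction s using Finset.induction_on with
  | empty => simp
  | insert a s ha ih => rw [Finset.sum_insert ha, Finset.prod_insert ha, zpow_add, ih]

theorem circle_coe_prod {ι : Type*} (s : Finset ι) (f : ι → Circle) :
    ((∏ k ∈ s, f k : Circle) : ℂ) = ∏ k ∈ s, (f k : ℂ) :=
  map_prod Circle.coeHom f s

theorem prod_zpow_single {n : ℕ} (u : Fin n → Circle) (a : Fin n) :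
    ∏ l, u l ^ (Pi.single a 1 : Fin n → ℤ) l = u a := by
  rw [Finset.prod_eq_single a]
  · simp
  · intro l _ hl
    simp [hl]
  · simp

theorem prod_zpow_biWeight {n : ℕ} (u : Fin n → Circle) (i : BiIdx n) :
    ∏ l, u l ^ biWeight i l = u i.1 * (u i.2)⁻¹ := by
  simp only [biWeight, Pi.sub_apply, zpow_sub, Finset.prod_mul_distrib, Finset.prod_inv_distrib,
    prod_zpow_single]

theorem prod_zpow_extWeight {n t : ℕ} (u : Fin n → Circle) (i : ExtIdx n t) :
    ∏ l, u l ^ extWeight i l = u i.1 * ∏ k, (u (i.2 k))⁻¹ := by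
  have h : ∏ l, u l ^ (∑ k, (Pi.single (i.2 k) 1 : Fin n → ℤ)) l = ∏ k, u (i.2 k) := by
    have hl : ∀ l, u l ^ (∑ k, (Pi.single (i.2 k) 1 : Fin n → ℤ)) l =
        ∏ k, u l ^ (Pi.single (i.2 k) 1 : Fin n → ℤ) l := by
      intro l
      rw [Finset.sum_apply]
      exact zpow_sum_eq_prod _ _ _
    simp only [hl]
    rw [Finset.prod_comm]
    simp only [prod_zpow_single]
  simp only [extWeight, Pi.sub_apply, zpow_sub, Finset.prod_mul_distrib, Finset.prod_inv_distrib,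
    prod_zpow_single, h]

theorem diagU_map_star {n : ℕ} (u : Fin n → Circle) :
    (diagU u).map star = Matrix.diagonal fun k => ((u k)⁻¹ : ℂ) := by
  rw [diagU, Matrix.diagonal_map (star_zero _)]
  congr 1
  funext k
  rw [← Circle.coe_inv, Circle.coe_inv_eq_conj]
  rfl

theorem localConj_diagU {n : ℕ} (u : Fin n → Circle) :
    localConj (diagU u) =
      Matrix.diagonal fun i => ((∏ l, u l ^ biWeight i l : Circle) : ℂ) := by
  rw [localConj, diagU_map_star, diagU, Matrix.diagonal_kronecker_diagonal]
  congr 1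
  funext i
  rw [prod_zpow_biWeight, Circle.coe_mul, Circle.coe_inv]

theorem tensorPow_diagonal {n : ℕ} (d : Fin n → ℂ) (t : ℕ) :
    tensorPow (Matrix.diagonal d) t = Matrix.diagonal fun i => ∏ k, d (i k) := by
  ext i j
  by_cases h : i = j
  · subst h
    simp [tensorPow]
  · obtain ⟨k, hk⟩ := Function.ne_iff.1 h
    rw [Matrix.diagonal_apply_ne _ h, tensorPow, Matrix.of_apply]
    exact Finset.prod_eq_zero (Finset.mem_univ k) (Matrix.diagonal_apply_ne _ hk)

theorem localConjExt_diagU {n : ℕ} (t : ℕ) (u : Fin n → Circle) :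
    localConjExt t (diagU u) =
      Matrix.diagonal fun i => ((∏ l, u l ^ extWeight i l : Circle) : ℂ) := by
  rw [localConjExt, diagU_map_star, tensorPow_diagonal, diagU, Matrix.diagonal_kronecker_diagonal]
  congr 1
  funext i
  rw [prod_zpow_extWeight, Circle.coe_mul, circle_coe_prod]
  simp only [Circle.coe_inv]

theorem diagonal_circle_conj_apply {κ : Type*} [Fintype κ] [DecidableEq κ] (c : κ → Circle)
    (A : Matrix κ κ ℂ) (i j : κ) :
    (Matrix.diagonal (fun i => (c i : ℂ)) * A *
      (Matrix.diagonal fun i => (c i : ℂ)).conjTranspose) i j =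
        A i j * ((c i * (c j)⁻¹ : Circle) : ℂ) := by
  rw [Matrix.diagonal_conjTranspose, Matrix.mul_diagonal, Matrix.diagonal_mul, Circle.coe_mul,
    Circle.coe_inv_eq_conj]
  change (c i : ℂ) * A i j * star (c j : ℂ) = A i j * ((c i : ℂ) * star (c j : ℂ))
  ring

theorem pinch_mem_cLDUIExt {n t : ℕ} {ρ : Matrix (ExtIdx n t) (ExtIdx n t) ℂ}
    (h : ρ.IsHermitian) : pinch extWeight ρ ∈ CLDUIExt n t := by
  refine ⟨pinch_isHermitian _ h, fun u => ?_⟩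
  ext i j
  rw [localConjExt_diagU, diagonal_circle_conj_apply, pinch_apply]
  split_ifs with hij
  · rw [hij, mul_inv_cancel, Circle.coe_one, mul_one]
  · rw [zero_mul]

theorem integral_fourier_unitAddCircle (m : ℤ) :
    ∫ θ : UnitAddCircle, (fourier m θ : ℂ) = if m = 0 then 1 else 0 := by
  split_ifs with h
  · subst h
    simp [MeasureTheory.measureReal_def]
  · exact MeasureTheory.integral_eq_zero_of_add_right_eq_neg
      (fourier_add_half_inv_index h one_pos)

/-- Conjugation multiplies each entry by the torus character of its weight difference, whose Haar
integral is 1 if that difference is zero and 0 otherwise. -/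
theorem projCLDUI_eq_pinch {n : ℕ} (M : Matrix (BiIdx n) (BiIdx n) ℂ) :
    projCLDUI M = pinch biWeight M := by
  ext i j
  have h : ∀ θ : Fin n → UnitAddCircle,
      (localConj (diagU fun k => AddCircle.toCircle (θ k)) * M *
        (localConj (diagU fun k => AddCircle.toCircle (θ k))).conjTranspose) i j =
      M i j * ∏ l, (fourier (biWeight i l - biWeight j l) (θ l) : ℂ) := by
    intro θ
    rw [localConj_diagU, diagonal_circle_conj_apply, ← Finset.prod_inv_distrib,
      ← Finset.prod_mul_distrib, circle_coe_prod]
    congr 1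
    refine Finset.prod_congr rfl fun l _ => ?_
    rw [← zpow_sub, fourier_apply, AddCircle.toCircle_zsmul]
  rw [projCLDUI, Matrix.of_apply]
  simp only [h]
  rw [MeasureTheory.integral_const_mul,
    MeasureTheory.integral_fintype_prod_volume_eq_prod
      (fun l θ => (fourier (biWeight i l - biWeight j l) θ : ℂ)), pinch_apply]
  simp only [integral_fourier_unitAddCircle, sub_eq_zero]
  split_ifs with hij
  · simp [hij]
  · obtain ⟨l, hl⟩ := Function.ne_iff.1 hij
    rw [Finset.prod_eq_zero (Finset.mem_univ l) (if_neg hl), mul_zero]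

end DPSHierarchy

theorem corollary3p3 (n t : ℕ) [NeZero t]
    (M : Matrix (DPSHierarchy.BiIdx n) (DPSHierarchy.BiIdx n) ℂ)
    (hM : M ∈ DPSHierarchy.DPSDual n t) :
    (∃ (B : Matrix (DPSHierarchy.ExtIdx n t) (DPSHierarchy.ExtIdx n t) ℂ)
        (W : Fin (t + 1) → Matrix (DPSHierarchy.ExtIdx n t) (DPSHierarchy.ExtIdx n t) ℂ),
        B ∈ DPSHierarchy.HermSymPerp n t ∩ DPSHierarchy.CLDUIExt n t ∧
        (∀ s : Fin (t + 1), W s ∈ DPSHierarchy.WCone n t s ∩ DPSHierarchy.CLDUIExt n t) ∧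
        DPSHierarchy.tensorId t (DPSHierarchy.projCLDUI M) = B + ∑ s, W s) ∧
      DPSHierarchy.projCLDUI M ∈ DPSHierarchy.DPSDual n t := by
  open DPSHierarchy in
  obtain ⟨B, W, hB, hW, hdec⟩ := exists_decomposition hM
  have hpinch : tensorId t (projCLDUI M) =
      pinch extWeight B + ∑ s, pinch extWeight (W s) := by
    rw [projCLDUI_eq_pinch, ← pinch_tensorId, hdec, pinch_add, pinch_sum]
  have hB' := pinch_mem_hermSymPerp hB
  have hW' : ∀ s : Fin (t + 1), pinch extWeight (W s) ∈ WCone n t s :=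
    fun s => pinch_mem_wCone (hW s)
  refine ⟨⟨pinch extWeight B, fun s => pinch extWeight (W s), ⟨hB', pinch_mem_cLDUIExt hB.1⟩,
    fun s => ⟨hW' s, pinch_mem_cLDUIExt (hW s).1⟩, hpinch⟩, ?_, ?_⟩
  · rw [projCLDUI_eq_pinch]
    exact pinch_isHermitian _ hM.1
  · rintro _ ⟨_, R, hR, hRpos, rfl⟩
    -- The B-term is orthogonal to R; each W-term becomes, after partial transposition of both
    -- factors, a pairing of two positive semidefinite matrices.
    rw [← traceInner_tensorId, hpinch, traceInner_add_left, hB'.2 R hR, zero_add,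
      traceInner_sum_left, Complex.re_sum]
    refine Finset.sum_nonneg fun s _ => ?_
    rw [← traceInner_partialTranspose s]
    exact traceInner_re_nonneg (hW' s).2 (hRpos s (Nat.le_of_lt_succ s.2))
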